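/- Let $\mathcal A$ be a finite-dimensional (unital) $C^*$-algebra. Sesquilinear forms are conjugate-linear in the first and linear in the second variable. Let $\mathcal E$ be a $\mathbb C$-valued sesquilinear form on $\mathcal A$, and for $n\in\mathbb N$ let $\mathcal E_n$ be the sesquilinear form on $M_n(\mathcal A)$ given by $\mathcal E_n(X,Y)=\sum_{j,k}\mathcal E(x_{jk},y_{jk})$. Suppose that - $\mathcal E$ is real: $\mathcal E(a^*,b^*)=\mathcal E(b,a)$ for all $a,b\in\mathcal A$; - $\mathcal E$ is completely positive: $\mathcal E_n(X,X)\ge 0$ for all $n$ and all $X\in M_n(\mathcal A)$; - $\mathcal E$ is completely Markov: for all $n$, all $X=X^*\in M_n(\mathcal A)$ and every real-valued Lipschitz function $F$ on the spectrum $\sigma(X)$ one has $\mathcal E_n(F(X),F(X))\le \mathrm{Lip}(F)^2\,\mathcal E_n(X,X)$; - $1_{\mathcal A}$ is in the null-space of $\mathcal E$: $\mathcal E(1_{\mathcal A},b)=0$ for all $b\in\mathcal A$. Let $\tau$ be a faithful (positive, not necessarily normalized) trace on $\mathcal A$. Then there is a unique linear operator $N$ on $L^2(\mathcal A,\tau)$,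 i.e. on $\mathcal A$ with the inner product $\langle a,b\rangle_\tau=\tau(a^*b)$, such that $\mathcal E(a,b)=\langle a,Nb\rangle_\tau$ for all $a,b\in\mathcal A$. For this $N$, set $$\Gamma_N(a,b)=\tfrac12\bigl(N(a^*)b-N(a^*b)+a^*N(b)\bigr).$$ Then $\Gamma_N$ is a carré-du-champ for $\mathcal A$; that is, $\Gamma_N$ is an $\mathcal A$-valued sesquilinear form on $\mathcal A$ such that, for all $a,b,c\in\mathcal A$, - $\Gamma_N(a,b)^*=\Gamma_N(b,a)$ and $\Gamma_N(1_{\mathcal A},a)=0$, - $\Gamma_N(ab,c)-\Gamma_N(b,a^*c)=b^*\Gamma_N(a,c)-\Gamma_N(b,a^*)c$, - $\Gamma_N$ is completely positive: for all $n$ and $a_1,\dots,a_n\in\mathcal A$ the matrix $(\Gamma_N(a_j,a_k))_{j,k}$ is a positive element of $M_n(\mathcal A)$. Moreover $$\mathcal E(a,b)=\tau(\Gamma_N(a,b))\qquad\text{for all } a,b\in\mathcal A.$$ -/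

import Mathlib

open scoped ComplexOrder

namespace EnergyForm

/-- A faithful trace on a C*-algebra (not assumed to be normalized). -/
structure IsFaithfulTrace {A : Type*} [CStarAlgebra A] (τ : A →ₗ[ℂ] ℂ) : Prop where
  nonneg : ∀ a : A, 0 ≤ τ (star a * a)
  tracial : ∀ a b : A, τ (a * b) = τ (b * a)
  faithful : ∀ a : A, τ (star a * a) = 0 → a = 0

/-! Sesquilinear forms are conjugate-linear in the first variable and linear in the second. -/

/-- `E(a*, b*) = E(b, a)`. -/
def IsReal {A : Type*} [CStarAlgebra A] (E : A →ₗ⋆[ℂ] A →ₗ[ℂ] ℂ) : Prop :=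
  ∀ a b : A, E (star a) (star b) = E b a

/-- `E(a, a) ≥ 0` (which includes that `E(a, a)` is a real number). -/
def IsPositive {B : Type*} [CStarAlgebra B] (E : B →ₗ⋆[ℂ] B →ₗ[ℂ] ℂ) : Prop :=
  ∀ a : B, 0 ≤ E a a

/-- The Markov property: `E(F(a), F(a)) ≤ L² E(a, a)` for every self-adjoint `a` and every
real-valued function `F` on the spectrum of `a` that has `L` as a Lipschitz constant.
Here `F(a)` is given by the continuous functional calculus. -/
def IsMarkov {B : Type*} [CStarAlgebra B] (E : B →ₗ⋆[ℂ] B →ₗ[ℂ] ℂ) : Prop :=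
  ∀ a : B, IsSelfAdjoint a → ∀ (F : ℝ → ℝ) (L : NNReal), LipschitzOnWith L F (spectrum ℝ a) →
    E (cfc F a) (cfc F a) ≤ ((L : ℝ) : ℂ) ^ 2 * E a a

/-- The form `Eₙ(X, Y) = ∑ j k, E(X j k, Y j k)` on the C*-algebra `Mₙ(A)`. -/
noncomputable def matrixForm {A : Type*} [CStarAlgebra A] (E : A →ₗ⋆[ℂ] A →ₗ[ℂ] ℂ) (n : ℕ) :
    CStarMatrix (Fin n) (Fin n) A →ₗ⋆[ℂ] CStarMatrix (Fin n) (Fin n) A →ₗ[ℂ] ℂ :=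
  LinearMap.mk₂'ₛₗ (starRingEnd ℂ) (RingHom.id ℂ) (fun X Y => ∑ j, ∑ k, E (X j k) (Y j k))
    (fun X X' Y => by simp [Finset.sum_add_distrib])
    (fun c X Y => by simp [Finset.mul_sum])
    (fun X Y Y' => by simp [Finset.sum_add_distrib])
    (fun c X Y => by simp [Finset.mul_sum])

/-- A (right) quasi-carré-du-champ: a symmetric `A`-valued sesquilinear form that vanishes on
`1` and satisfies the *-representation condition. -/
structure IsQuasiCarreDuChamp {A : Type*} [CStarAlgebra A] (Γ : A →ₗ⋆[ℂ] A →ₗ[ℂ] A) : Prop where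
  symm : ∀ a b : A, star (Γ a b) = Γ b a
  one_left : ∀ a : A, Γ 1 a = 0
  star_rep : ∀ a b c : A,
    Γ (a * b) c - Γ b (star a * c) = star b * Γ a c - Γ b (star a) * c

section MatrixAlgebra

variable {A : Type*} [CStarAlgebra A] [PartialOrder A] [StarOrderedRing A]

/-- Every `Eₙ` is positive. -/
def IsCompletelyPositive (E : A →ₗ⋆[ℂ] A →ₗ[ℂ] ℂ) : Prop :=
  ∀ n : ℕ, IsPositive (matrixForm E n)

/-- Every `Eₙ` is Markov. -/
def IsCompletelyMarkov (E : A →ₗ⋆[ℂ] A →ₗ[ℂ] ℂ) : Prop :=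
  ∀ n : ℕ, IsMarkov (matrixForm E n)

/-- A (right) carré-du-champ: a quasi-carré-du-champ that is completely positive, i.e. every
matrix `(Γ(a j, a k))` is a positive element of the C*-algebra `Mₙ(A)`. -/
structure IsCarreDuChamp (Γ : A →ₗ⋆[ℂ] A →ₗ[ℂ] A) : Prop extends IsQuasiCarreDuChamp Γ where
  completely_positive : ∀ (n : ℕ) (a : Fin n → A),
    0 ≤ (CStarMatrix.ofMatrix (Matrix.of fun j k => Γ (a j) (a k)) :
      CStarMatrix (Fin n) (Fin n) A)

end MatrixAlgebra

/-- `Γ_N(a, b) = (1/2) (N(a*) b - N(a* b) + a* N(b))`. -/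
noncomputable def gammaForm {A : Type*} [CStarAlgebra A] (N : A →ₗ[ℂ] A) :
    A →ₗ⋆[ℂ] A →ₗ[ℂ] A :=
  LinearMap.mk₂'ₛₗ (starRingEnd ℂ) (RingHom.id ℂ)
    (fun a b => (1 / 2 : ℂ) • (N (star a) * b - N (star a * b) + star a * N b))
    (fun a a' b => by
      simp only [star_add, map_add, add_mul, ← smul_add]; congr 1; abel)
    (fun c a b => by
      simp only [star_smul, map_smul, smul_mul_assoc, starRingEnd_apply]
      rw [smul_comm, ← smul_sub, ← smul_add])
    (fun a b b' => by
      simp only [map_add, mul_add, ← smul_add]; congr 1; abel)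
    (fun c a b => by
      simp only [map_smul, mul_smul_comm, RingHom.id_apply]
      rw [smul_comm, ← smul_sub, ← smul_add])

end EnergyForm

/-! Faithfulness of `τ` makes the pairing nondegenerate, so `N` exists and is unique; the algebraic
identities of `Γ_N` need only that `N` respects the involution and kills `1`. The substance is
complete positivity. The Markov property for `|t|`, applied to `p - r`, gives `E(p, r) ≤ 0` for
orthogonal positive `p`, `r` (`IsMarkov.apply_nonpos`); dually, `-N p` compressed by `1 - p` is
positive for a projection `p` (`corner_generator_nonneg`). If `x` is self-adjoint with spectral
projections `p i`, then `2Γ(x, x) = ∑ (i - x)(-N (p i))(i - x)`, and `i - x` absorbs `1 - p i`, so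
each term is positive (`gammaForm_self_nonneg`). All hypotheses pass to matrices, and a bordered
self-adjoint matrix turns this into positivity of `(Γ(a j, a k))`. -/

namespace EnergyForm

/-! ### Hermitian forms, duality under the trace, spectral projections -/

section Sesquilinear

variable {B : Type*} [CStarAlgebra B]

/-- A positive sesquilinear form is Hermitian. -/
theorem IsPositive.conj_symm {E : B →ₗ⋆[ℂ] B →ₗ[ℂ] ℂ} (h : IsPositive E) (a b : B) :
    star (E a b) = E b a := by
  have im0 : ∀ x, (E x x).im = 0 := fun x => ((Complex.nonneg_iff.mp (h x)).2).symm
  -- Polarization: `a + b` controls the imaginary parts of `E a b` and `E b a`, `a + i b` their real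
  -- parts.
  have h1 := im0 (a + b)
  have h2 := im0 (a + Complex.I • b)
  rw [map_add, map_add, map_smulₛₗ, map_smulₛₗ] at h2
  simp only [map_add, LinearMap.add_apply, Complex.add_im, im0] at h1
  simp [im0] at h2
  apply Complex.ext
  · simp; linarith
  · simp; linarith

/-- The form `⟨a, b⟩ = τ (a* b)`. -/
noncomputable def traceForm (τ : B →ₗ[ℂ] ℂ) : B →ₗ⋆[ℂ] B →ₗ[ℂ] ℂ :=
  LinearMap.mk₂'ₛₗ (starRingEnd ℂ) (RingHom.id ℂ) (fun a b => τ (star a * b))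
    (fun a a' b => by simp [add_mul])
    (fun c a b => by simp)
    (fun a b b' => by simp [mul_add])
    (fun c a b => by simp)

theorem IsFaithfulTrace.star_apply {τ : B →ₗ[ℂ] ℂ} (hτ : IsFaithfulTrace τ) (a : B) :
    star (τ a) = τ (star a) := by
  have h : IsPositive (traceForm τ) := hτ.nonneg
  have := h.conj_symm 1 a
  simpa [traceForm] using this

theorem IsFaithfulTrace.ext {τ : B →ₗ[ℂ] ℂ} (hτ : IsFaithfulTrace τ) {x y : B}
    (h : ∀ a : B, τ (star a * x) = τ (star a * y)) : x = y := by
  refine sub_eq_zero.mp (hτ.faithful _ ?_)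
  rw [mul_sub, map_sub, h, sub_self]

/-- Every sesquilinear form on a finite-dimensional algebra is represented by an operator. -/
theorem IsFaithfulTrace.exists_generator [FiniteDimensional ℂ B] {τ : B →ₗ[ℂ] ℂ}
    (hτ : IsFaithfulTrace τ) (E : B →ₗ⋆[ℂ] B →ₗ[ℂ] ℂ) :
    ∃ N : B →ₗ[ℂ] B, ∀ a b : B, E a b = τ (star a * N b) := by
  let T : B →ₗ[ℂ] Module.Dual ℂ B :=
    LinearMap.mk₂ ℂ (fun b a => τ (a * b)) (by simp [mul_add]) (by simp) (by simp [add_mul])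
      (by simp)
  let S : B →ₗ[ℂ] Module.Dual ℂ B :=
    LinearMap.mk₂ ℂ (fun b a => E (star a) b) (by simp) (by simp) (by simp) (by simp)
  have hT : Function.Injective T := by
    intro x y h
    refine hτ.ext fun a => ?_
    exact LinearMap.congr_fun h (star a)
  let e := LinearEquiv.ofInjectiveOfFinrankEq T hT (Subspace.dual_finrank_eq).symm
  refine ⟨e.symm.toLinearMap ∘ₗ S, fun a b => ?_⟩
  have h : T (e.symm (S b)) = S b := e.apply_symm_apply (S b)
  have := LinearMap.congr_fun h (star a)
  simpa [T, S] using this.symm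

/-- Spectral decomposition of a self-adjoint element of a finite-dimensional algebra. -/
theorem exists_spectral_decomposition [FiniteDimensional ℂ B] {x : B} (hx : IsSelfAdjoint x) :
    ∃ (s : Finset ℝ) (p : ℝ → B), (∀ i, IsSelfAdjoint (p i)) ∧ (∀ i, p i * p i = p i) ∧
      (∀ i, x * p i = i • p i) ∧ ∑ i ∈ s, p i = 1 := by
  have hfin : (spectrum ℝ x).Finite := by
    have : FiniteDimensional ℝ B := FiniteDimensional.trans ℝ ℂ B
    have hint : IsIntegral ℝ x := IsIntegral.of_finite ℝ x
    refine (Polynomial.rootSet_finite (minpoly ℝ x) ℝ).subset fun i hi => ?_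
    rw [Polynomial.mem_rootSet]
    refine ⟨minpoly.ne_zero hint, ?_⟩
    have h := spectrum.subset_polynomial_aeval x (minpoly ℝ x) ⟨i, hi, rfl⟩
    rw [minpoly.aeval] at h
    by_contra hne
    refine h ?_
    rw [spectrum.mem_resolventSet_iff, sub_zero]
    exact (IsUnit.mk0 _ hne).map (algebraMap ℝ B)
  -- On a finite spectrum every function is continuous, so indicators of points are allowed in
  -- `cfc`.
  have hc : ∀ f : ℝ → ℝ, ContinuousOn f (spectrum ℝ x) := fun f => hfin.continuousOn f
  refine ⟨hfin.toFinset, fun i => cfc (fun t => if t = i then (1 : ℝ) else 0) x,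
    fun i => cfc_predicate _ _, fun i => ?_, fun i => ?_, ?_⟩
  · rw [← cfc_mul _ _ x (hc _) (hc _)]
    congr 1; ext t; split_ifs <;> simp
  · conv_lhs => rw [← cfc_id' ℝ x hx, cfc_id' ℝ x hx]
    nth_rw 1 [← cfc_id' ℝ x hx]
    rw [← cfc_mul _ _ x (hc _) (hc _), ← cfc_smul _ _ x (hc _)]
    congr 1; ext t; by_cases h : t = i <;> simp [h]
  · rw [← cfc_sum _ x _ (fun i _ => hc _)]
    rw [← cfc_one ℝ x hx]
    refine cfc_congr fun t ht => ?_
    simp [ht]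

end Sesquilinear

/-! ### Algebraic properties of the generator and of `Γ_N` -/

section Generator

variable {B : Type*} [CStarAlgebra B] {E : B →ₗ⋆[ℂ] B →ₗ[ℂ] ℂ} {τ : B →ₗ[ℂ] ℂ} {N : B →ₗ[ℂ] B}

theorem gammaForm_apply (N : B →ₗ[ℂ] B) (a b : B) :
    gammaForm N a b = (1 / 2 : ℂ) • (N (star a) * b - N (star a * b) + star a * N b) := rfl

/-- The operator representing a real positive form commutes with the involution. -/
theorem generator_star (hreal : IsReal E) (hpos : IsPositive E) (hτ : IsFaithfulTrace τ)
    (hN : ∀ a b : B, E a b = τ (star a * N b)) (b : B) : N (star b) = star (N b) := by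
  refine hτ.ext fun a => ?_
  have h1 : E a (star b) = E b (star a) := by simpa using hreal (star a) b
  rw [← hN, h1, ← hpos.conj_symm, hN, hτ.star_apply, star_mul, star_star, hτ.tracial]

theorem generator_one (hone : ∀ b : B, E 1 b = 0) (hreal : IsReal E) (hτ : IsFaithfulTrace τ)
    (hN : ∀ a b : B, E a b = τ (star a * N b)) : N 1 = 0 := by
  refine hτ.ext fun a => ?_
  have := hreal (star a) 1
  rw [star_star, star_one, hone] at this
  rw [← hN, this, mul_zero, map_zero]

/-- `Γ_N` is a quasi-carré-du-champ as soon as `N` is Hermitian and kills `1`. -/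
theorem isQuasiCarreDuChamp_gammaForm (hstar : ∀ b, N (star b) = star (N b)) (h1 : N 1 = 0) :
    IsQuasiCarreDuChamp (gammaForm N) where
  symm a b := by
    simp only [gammaForm_apply, star_smul, star_add, star_sub, star_mul, ← hstar, star_star]
    rw [show star (1 / 2 : ℂ) = 1 / 2 by simp]
    module
  one_left a := by simp [gammaForm_apply, h1]
  star_rep a b c := by
    simp only [gammaForm_apply, star_mul, mul_smul_comm, smul_mul_assoc, ← smul_sub]
    congr 1
    simp only [mul_add, add_mul, mul_sub, sub_mul, mul_assoc]
    abel

/-- The outer terms of `Γ_N` each have trace `E a b`; the middle one has trace `E 1 (a* b) = 0`. -/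
theorem trace_gammaForm (hone : ∀ b : B, E 1 b = 0) (hreal : IsReal E) (hτ : IsFaithfulTrace τ)
    (hN : ∀ a b : B, E a b = τ (star a * N b)) (a b : B) : E a b = τ (gammaForm N a b) := by
  have h1 : τ (N (star a) * b) = E a b := by
    have := hN (star b) (star a)
    rwa [star_star, hreal, hτ.tracial, eq_comm] at this
  have h2 : τ (N (star a * b)) = 0 := by
    simpa [hone] using (hN 1 (star a * b)).symm
  rw [gammaForm_apply, map_smul, map_add, map_sub, h1, h2, ← hN, smul_eq_mul]
  ring

end Generator

/-! ### From the Markov property to positivity on self-adjoint elements -/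

section Order

variable {B : Type*} [CStarAlgebra B] [PartialOrder B] [StarOrderedRing B]

/-- Orthogonality gives `(p - r)² = (p + r)²`, and the positive square root is unique. -/
theorem cfc_abs_sub_of_mul_eq_zero {p r : B} (hp : 0 ≤ p) (hr : 0 ≤ r) (h : p * r = 0) :
    cfc (fun t : ℝ => |t|) (p - r) = p + r := by
  have hps := IsSelfAdjoint.of_nonneg hp
  have hrs := IsSelfAdjoint.of_nonneg hr
  have h' : r * p = 0 := by simpa [hps.star_eq, hrs.star_eq] using congrArg star h
  have hsa : IsSelfAdjoint (p - r) := hps.sub hrs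
  have := CFC.abs_eq_cfc_norm (p - r) hsa
  simp only [Real.norm_eq_abs] at this
  rw [← this, CFC.abs, hsa.star_eq]
  refine CFC.sqrt_unique ?_ (add_nonneg hp hr)
  simp [mul_add, add_mul, mul_sub, sub_mul, h, h']

/-- The Markov property makes the form nonpositive on pairs of orthogonal positive elements. -/
theorem IsMarkov.apply_nonpos {E : B →ₗ⋆[ℂ] B →ₗ[ℂ] ℂ} (hE : IsMarkov E) (hreal : IsReal E)
    {p r : B} (hp : 0 ≤ p) (hr : 0 ≤ r) (h : p * r = 0) : E p r ≤ 0 := by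
  have hps := IsSelfAdjoint.of_nonneg hp
  have hrs := IsSelfAdjoint.of_nonneg hr
  have hL : LipschitzOnWith 1 (fun t : ℝ => |t|) (spectrum ℝ (p - r)) :=
    (lipschitzWith_one_norm (E := ℝ)).lipschitzOnWith
  have key := hE (p - r) (hps.sub hrs) _ 1 hL
  rw [cfc_abs_sub_of_mul_eq_zero hp hr h] at key
  -- By this symmetry `E(p + r, p + r) ≤ E(p - r, p - r)` reduces to `4 E(p, r) ≤ 0`.
  have hs : E r p = E p r := by simpa [hps.star_eq, hrs.star_eq] using hreal r p
  simp only [map_add, map_sub, LinearMap.add_apply, LinearMap.sub_apply, hs, NNReal.coe_one,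
    Complex.ofReal_one, one_pow, one_mul] at key
  rw [Complex.le_def] at key ⊢
  simp only [Complex.add_re, Complex.sub_re, Complex.add_im, Complex.sub_im, Complex.zero_re,
    Complex.zero_im] at key ⊢
  constructor <;> linarith [key.1, key.2]

theorem exists_eq_star_mul_self {b : B} (hb : 0 ≤ b) : ∃ z, b = star z * z :=
  CStarAlgebra.nonneg_iff_eq_star_mul_self.mp hb

/-- A self-adjoint element is positive if it pairs nonnegatively with all positive elements. -/
theorem IsFaithfulTrace.nonneg_of_forall {τ : B →ₗ[ℂ] ℂ} (hτ : IsFaithfulTrace τ) {y : B}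
    (hy : IsSelfAdjoint y) (h : ∀ b : B, 0 ≤ b → 0 ≤ τ (b * y)) : 0 ≤ y := by
  rw [← CFC.negPart_eq_zero_iff y hy]
  have hs : star (y⁻) = y⁻ := (IsSelfAdjoint.of_nonneg (CFC.negPart_nonneg y)).star_eq
  refine hτ.faithful _ (le_antisymm ?_ (hτ.nonneg _))
  -- Testing against `y⁻` gives `-τ(y⁻ y⁻) ≥ 0`.
  have h1 := h _ (CFC.negPart_nonneg y)
  have h2 : y⁻ * y = -(y⁻ * y⁻) := by
    nth_rw 2 [← CFC.posPart_sub_negPart y hy]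
    rw [mul_sub, CFC.negPart_mul_posPart, zero_sub]
  rw [h2, map_neg] at h1
  rw [hs]
  exact neg_nonneg.mp h1

variable {E : B →ₗ⋆[ℂ] B →ₗ[ℂ] ℂ} {τ : B →ₗ[ℂ] ℂ} {N : B →ₗ[ℂ] B}

/-- The off-diagonal corner of `N p` for a projection `p` is nonpositive. -/
theorem corner_generator_nonneg (hE : IsMarkov E) (hreal : IsReal E) (hpos : IsPositive E)
    (hτ : IsFaithfulTrace τ) (hN : ∀ a b : B, E a b = τ (star a * N b)) {p : B}
    (hp : IsSelfAdjoint p) (hpp : p * p = p) : 0 ≤ (1 - p) * -N p * (1 - p) := by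
  have hNp : IsSelfAdjoint (N p) := by
    rw [IsSelfAdjoint, ← generator_star hreal hpos hτ hN, hp.star_eq]
  have hq : IsSelfAdjoint (1 - p) := (IsSelfAdjoint.one B).sub hp
  refine hτ.nonneg_of_forall ?_ fun b hb => ?_
  · simpa [hq.star_eq] using hNp.neg.conjugate' (1 - p)
  have hr : 0 ≤ (1 - p) * b * (1 - p) := hq.conjugate_nonneg hb
  have hp0 : 0 ≤ p := by simpa [hp.star_eq, hpp] using star_mul_self_nonneg p
  have h0 : (1 - p) * b * (1 - p) * p = 0 := by
    rw [mul_assoc _ (1 - p) p, sub_mul 1 p p, one_mul, hpp, sub_self, mul_zero]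
  have h := IsMarkov.apply_nonpos hE hreal hr hp0 h0
  rw [hN, (IsSelfAdjoint.of_nonneg hr).star_eq] at h
  have e : τ (b * ((1 - p) * -N p * (1 - p))) = - τ ((1 - p) * b * (1 - p) * N p) := by
    rw [← mul_assoc, hτ.tracial, ← map_neg τ]
    congr 1
    simp only [mul_assoc, mul_neg]
  rw [e]
  exact neg_nonneg.mpr h

theorem gammaForm_self_nonneg [FiniteDimensional ℂ B] (hE : IsMarkov E) (hreal : IsReal E)
    (hpos : IsPositive E) (hone : ∀ b : B, E 1 b = 0) (hτ : IsFaithfulTrace τ)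
    (hN : ∀ a b : B, E a b = τ (star a * N b)) {x : B} (hx : IsSelfAdjoint x) :
    0 ≤ gammaForm N x x := by
  obtain ⟨s, p, hsa, hidem, hxp, hsum⟩ := exists_spectral_decomposition hx
  have hpx : ∀ i, p i * x = i • p i := fun i => by
    simpa [hx.star_eq, (hsa i).star_eq] using congrArg star (hxp i)
  have hx1 : x = ∑ i ∈ s, i • p i := by
    rw [← mul_one x, ← hsum, Finset.mul_sum]; simp [hxp]
  have hx2 : x * x = ∑ i ∈ s, (i * i) • p i := by
    nth_rw 2 [hx1]; simp [Finset.mul_sum, hxp, mul_smul]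
  have hN0 : ∑ i ∈ s, N (p i) = 0 := by
    rw [← map_sum, hsum, generator_one hone hreal hτ hN]
  have hN1 : N x = ∑ i ∈ s, i • N (p i) := by
    conv_lhs => rw [hx1]
    simp [map_sum]
  have hN2 : N (x * x) = ∑ i ∈ s, (i * i) • N (p i) := by
    rw [hx2]; simp [map_sum]
  -- Summed over `i`, the expansion also yields `-x (∑ N (p i)) x`, which vanishes because `N 1 =
  -- 0`.
  have key : N x * x - N (x * x) + x * N x
      = ∑ i ∈ s, (i • 1 - x) * -N (p i) * (i • 1 - x) := by
    have : ∀ i, (i • 1 - x) * -N (p i) * (i • 1 - x)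
        = (i • N (p i)) * x - (i * i) • N (p i) + x * (i • N (p i)) - x * N (p i) * x := by
      intro i
      simp only [mul_neg, neg_mul, sub_mul, mul_sub, smul_mul_assoc, one_mul, mul_smul_comm,
        mul_one]
      module
    simp only [this, Finset.sum_sub_distrib, Finset.sum_add_distrib, ← Finset.sum_mul,
      ← Finset.mul_sum, ← hN1, ← hN2, hN0, mul_zero, zero_mul, sub_zero]
  rw [gammaForm_apply, hx.star_eq, key]
  refine smul_nonneg (by positivity) (Finset.sum_nonneg fun i _ => ?_)
  have h1 : (i • (1 : B) - x) * (1 - p i) = i • 1 - x := by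
    rw [mul_sub, mul_one, sub_mul, hxp, smul_mul_assoc, one_mul, sub_self, sub_zero]
  have h2 : (1 - p i) * (i • (1 : B) - x) = i • 1 - x := by
    rw [sub_mul, one_mul, mul_sub, hpx, mul_smul_comm, mul_one, sub_self, sub_zero]
  have hc : IsSelfAdjoint (i • (1 : B) - x) :=
    ((IsSelfAdjoint.all i).smul (IsSelfAdjoint.one B)).sub hx
  have := hc.conjugate_nonneg (corner_generator_nonneg hE hreal hpos hτ hN (hsa i) (hidem i))
  rwa [← mul_assoc, ← mul_assoc, h1, mul_assoc _ (1 - p i), h2] at this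

end Order

/-! ### Entrywise extension of the data to matrices -/

section Matrix

variable {A : Type*} [CStarAlgebra A] {n : ℕ}

theorem matrixForm_apply (E : A →ₗ⋆[ℂ] A →ₗ[ℂ] ℂ) (X Y : CStarMatrix (Fin n) (Fin n) A) :
    matrixForm E n X Y = ∑ j, ∑ k, E (X j k) (Y j k) := rfl

theorem IsReal.matrixForm {E : A →ₗ⋆[ℂ] A →ₗ[ℂ] ℂ} (h : IsReal E)
    (X Y : CStarMatrix (Fin n) (Fin n) A) :
    matrixForm E n (star X) (star Y) = matrixForm E n Y X := by
  simp only [matrixForm_apply, CStarMatrix.star_apply, h _ _]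
  exact Finset.sum_comm

theorem matrixForm_one_left {E : A →ₗ⋆[ℂ] A →ₗ[ℂ] ℂ} (hone : ∀ b : A, E 1 b = 0)
    (X : CStarMatrix (Fin n) (Fin n) A) : matrixForm E n 1 X = 0 := by
  rw [matrixForm_apply]
  refine Finset.sum_eq_zero fun j _ => Finset.sum_eq_zero fun k _ => ?_
  rw [CStarMatrix.one_apply]
  split_ifs <;> simp [hone]

/-- The trace `X ↦ ∑ j, τ (X j j)` on matrices. -/
noncomputable def matrixTrace (τ : A →ₗ[ℂ] ℂ) (n : ℕ) : CStarMatrix (Fin n) (Fin n) A →ₗ[ℂ] ℂ where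
  toFun X := ∑ j, τ (X j j)
  map_add' X Y := by simp [Finset.sum_add_distrib]
  map_smul' c X := by simp [Finset.mul_sum]

theorem matrixTrace_star_mul (τ : A →ₗ[ℂ] ℂ) (X Y : CStarMatrix (Fin n) (Fin n) A) :
    matrixTrace τ n (star X * Y) = ∑ j, ∑ k, τ (star (X j k) * Y j k) := by
  rw [Finset.sum_comm]
  simp [matrixTrace, CStarMatrix.mul_apply, CStarMatrix.star_apply]

/-- The entrywise action of an operator on matrices. -/
noncomputable def matrixMap (N : A →ₗ[ℂ] A) (n : ℕ) :
    CStarMatrix (Fin n) (Fin n) A →ₗ[ℂ] CStarMatrix (Fin n) (Fin n) A :=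
  CStarMatrix.mapₗ N

theorem matrixMap_apply (N : A →ₗ[ℂ] A) (X : CStarMatrix (Fin n) (Fin n) A) (j k : Fin n) :
    matrixMap N n X j k = N (X j k) := rfl

theorem matrixForm_eq_matrixTrace {E : A →ₗ⋆[ℂ] A →ₗ[ℂ] ℂ} {τ : A →ₗ[ℂ] ℂ} {N : A →ₗ[ℂ] A}
    (hN : ∀ a b : A, E a b = τ (star a * N b)) (X Y : CStarMatrix (Fin n) (Fin n) A) :
    matrixForm E n X Y = matrixTrace τ n (star X * matrixMap N n Y) := by
  simp only [matrixForm_apply, matrixTrace_star_mul, hN, matrixMap_apply]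

theorem gammaForm_matrixMap_apply {A : Type*} [CStarAlgebra A] [PartialOrder A]
    [StarOrderedRing A] {n : ℕ} (N : A →ₗ[ℂ] A) (X Y : CStarMatrix (Fin n) (Fin n) A)
    (j k : Fin n) :
    gammaForm (matrixMap N n) X Y j k = ∑ l, gammaForm N (X l j) (Y l k) := by
  rw [gammaForm_apply]
  simp [gammaForm_apply, CStarMatrix.mul_apply, CStarMatrix.star_apply, matrixMap_apply,
    Finset.sum_add_distrib, Finset.sum_sub_distrib, ← Finset.smul_sum]

instance [FiniteDimensional ℂ A] : FiniteDimensional ℂ (CStarMatrix (Fin n) (Fin n) A) :=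
  Module.Finite.equiv (CStarMatrix.ofMatrixₗ : Matrix (Fin n) (Fin n) A ≃ₗ[ℂ] _)

end Matrix

/-! ### Positivity in matrix algebras -/

section MatrixAlgebra

variable {A : Type*} [CStarAlgebra A] [PartialOrder A] [StarOrderedRing A] {n : ℕ}

theorem IsFaithfulTrace.matrixTrace {τ : A →ₗ[ℂ] ℂ} (hτ : IsFaithfulTrace τ) :
    IsFaithfulTrace (matrixTrace τ n) where
  nonneg X := by
    rw [matrixTrace_star_mul]
    exact Finset.sum_nonneg fun j _ => Finset.sum_nonneg fun k _ => hτ.nonneg _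
  tracial X Y := by
    simp only [EnergyForm.matrixTrace, CStarMatrix.mul_apply, LinearMap.coe_mk, AddHom.coe_mk,
      map_sum]
    rw [Finset.sum_comm]
    simp only [hτ.tracial]
  faithful X h := by
    rw [matrixTrace_star_mul, Finset.sum_eq_zero_iff_of_nonneg
      fun j _ => Finset.sum_nonneg fun k _ => hτ.nonneg (X j k)] at h
    ext j k
    have := h j (Finset.mem_univ j)
    rw [Finset.sum_eq_zero_iff_of_nonneg fun k _ => hτ.nonneg (X j k)] at this
    exact hτ.faithful _ (this k (Finset.mem_univ k))

theorem ofMatrix_star_mul_nonneg (v : Fin n → A) :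
    0 ≤ (CStarMatrix.ofMatrix (Matrix.of fun j k => star (v j) * v k) :
      CStarMatrix (Fin n) (Fin n) A) := by
  cases n with
  | zero => exact le_of_eq (CStarMatrix.ext fun j => j.elim0)
  | succ m =>
    -- A matrix whose only nonzero row is `v`; such a row needs `n > 0`.
    let V : CStarMatrix (Fin (m + 1)) (Fin (m + 1)) A :=
      CStarMatrix.ofMatrix (Matrix.of fun j k => if j = 0 then v k else 0)
    convert star_mul_self_nonneg V using 1
    ext j k
    simp [CStarMatrix.mul_apply, CStarMatrix.star_apply, V]

/-- A principal compression of a positive matrix is positive. -/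
theorem submatrix_succ_nonneg {G : CStarMatrix (Fin (n + 1)) (Fin (n + 1)) A} (hG : 0 ≤ G) :
    0 ≤ (CStarMatrix.ofMatrix (Matrix.of fun j k => G (Fin.succ j) (Fin.succ k)) :
      CStarMatrix (Fin n) (Fin n) A) := by
  obtain ⟨Z, rfl⟩ := exists_eq_star_mul_self hG
  -- Each row of `Z`, with its first entry dropped, contributes one rank-one Gram matrix.
  convert Finset.sum_nonneg (s := Finset.univ)
    fun l _ => ofMatrix_star_mul_nonneg fun j : Fin n => Z l (Fin.succ j) using 1
  ext j k
  rw [CStarMatrix.ofMatrix_apply, Matrix.of_apply, CStarMatrix.mul_apply]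
  simp only [CStarMatrix.star_apply]
  exact (Matrix.sum_apply j k Finset.univ fun l => Matrix.of fun j k : Fin n =>
    star (Z l j.succ) * Z l k.succ).symm

theorem gammaForm_completely_positive [FiniteDimensional ℂ A] {E : A →ₗ⋆[ℂ] A →ₗ[ℂ] ℂ}
    (hreal : IsReal E) (hpos : IsCompletelyPositive E) (hmarkov : IsCompletelyMarkov E)
    (hone : ∀ b : A, E 1 b = 0) {τ : A →ₗ[ℂ] ℂ} (hτ : IsFaithfulTrace τ) {N : A →ₗ[ℂ] A}
    (hN : ∀ a b : A, E a b = τ (star a * N b)) (a : Fin n → A) :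
    0 ≤ (CStarMatrix.ofMatrix (Matrix.of fun j k => gammaForm N (a j) (a k)) :
      CStarMatrix (Fin n) (Fin n) A) := by
  -- First row `(0, a)`, first column `(0, a*)`, zeros elsewhere: in the lower block of `Γ(X, X)`
  -- only the row index `l = 0` contributes, leaving `Γ(a j, a k)`.
  let X : CStarMatrix (Fin (n + 1)) (Fin (n + 1)) A := CStarMatrix.ofMatrix (Matrix.of
    (Fin.cons (Fin.cons 0 a) fun j => Fin.cons (star (a j)) fun _ => 0))
  have hX : IsSelfAdjoint X := by
    ext j k
    rw [CStarMatrix.star_apply]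
    refine Fin.cases ?_ (fun j => ?_) j <;> refine Fin.cases ?_ (fun k => ?_) k <;> simp [X]
  have h := gammaForm_self_nonneg (hmarkov (n + 1)) hreal.matrixForm (hpos (n + 1))
    (matrixForm_one_left hone) hτ.matrixTrace (matrixForm_eq_matrixTrace hN) hX
  convert submatrix_succ_nonneg h using 1
  ext j k
  rw [CStarMatrix.ofMatrix_apply, CStarMatrix.ofMatrix_apply, Matrix.of_apply, Matrix.of_apply,
    gammaForm_matrixMap_apply, Fin.sum_univ_succ]
  simp [X]

end MatrixAlgebra

end EnergyForm

theorem mainTheorem2 {A : Type*} [CStarAlgebra A] [PartialOrder A] [StarOrderedRing A]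
    [FiniteDimensional ℂ A] (E : A →ₗ⋆[ℂ] A →ₗ[ℂ] ℂ)
    (hreal : EnergyForm.IsReal E)
    (hpos : EnergyForm.IsCompletelyPositive E)
    (hmarkov : EnergyForm.IsCompletelyMarkov E)
    (hone : ∀ b : A, E 1 b = 0)
    (τ : A →ₗ[ℂ] ℂ) (hτ : EnergyForm.IsFaithfulTrace τ) :
    (∃! N : A →ₗ[ℂ] A, ∀ a b : A, E a b = τ (star a * N b)) ∧
    ∀ N : A →ₗ[ℂ] A, (∀ a b : A, E a b = τ (star a * N b)) →
      EnergyForm.IsCarreDuChamp (EnergyForm.gammaForm N) ∧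
      ∀ a b : A, E a b = τ (EnergyForm.gammaForm N a b) := by
  refine ⟨?_, fun N hN => ⟨?_, EnergyForm.trace_gammaForm hone hreal hτ hN⟩⟩
  · obtain ⟨N, hN⟩ := hτ.exists_generator E
    refine ⟨N, hN, fun M hM => LinearMap.ext fun b => hτ.ext fun a => ?_⟩
    rw [← hM, ← hN]
  · have hpos1 : EnergyForm.IsPositive E := fun a => by
      have := hpos 1 (CStarMatrix.ofMatrix (Matrix.of fun _ _ => a))
      simpa [EnergyForm.matrixForm_apply] using this
    exact
      { EnergyForm.isQuasiCarreDuChamp_gammaForm (EnergyForm.generator_star hreal hpos1 hτ hN)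
          (EnergyForm.generator_one hone hreal hτ hN) with
        completely_positive := fun n a =>
          EnergyForm.gammaForm_completely_positive hreal hpos hmarkov hone hτ hN a }
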